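/- Let $X$ be a real normed vector space with closed unit ball $D_X$ and topological dual $X^*$, let $K\subset X$ be a closed convex cone (with $0\in K$), and put $K^+=\{x^*\in X^*\mid x^*(k)\ge 0\ \forall k\in K\}$. A set $A\subset X$ is called $K$-bounded if $A\subset \ell D_X+K$ for some $\ell\ge 0$, and dually $K$-bounded if $x^*(A)$ is bounded from below for every $x^*\in K^+$. For nonempty $A\subset X$ put $\tilde A=\operatorname{cl}\operatorname{conv}(A+K)$, and let $$\mathcal C_{K^+}(X)=\{\tilde A\mid A\subset X \text{ nonempty and dually } K\text{-bounded}\},$$ with the operations $\tilde A\oplus\tilde B=\widetilde{A+B}$ and $\lambda\odot\tilde A=\widetilde{\lambda A}$ for $\lambda\ge 0$. This is a commutative monoid with cancellation and neutral element $K$. Its Rådström space $\mathcal G_{K^+}(X)$ is the real vector space of the classes $\langle\tilde A,\tilde B\rangle$ of pairs of elements of $\mathcal C_{K^+}(X)$ for the equivalence relation $$(\tilde A,\tilde B)\sim(\tilde C,\tilde D)\iff\tilde A\oplus\tilde D=\tilde B\oplus\tilde C,$$ with $\langle\tilde A,\tilde B\rangle+\langle\tilde C,\tilde D\rangle=\langle\tilde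 A\oplus\tilde C,\tilde B\oplus\tilde D\rangle$, with $\lambda\langle\tilde A,\tilde B\rangle=\langle\lambda\odot\tilde A,\lambda\odot\tilde B\rangle$ for $\lambda\ge 0$, and with $\lambda\langle\tilde A,\tilde B\rangle=\langle(-\lambda)\odot\tilde B,(-\lambda)\odot\tilde A\rangle$ for $\lambda<0$. Its ordering cone is $$\mathcal K_{K^+}(X)=\{\langle\tilde A,\tilde B\rangle\in\mathcal G_{K^+}(X)\mid\tilde A\subset\tilde B\}.$$ Let $\tau_{\mathcal P}$ be the locally convex topology on $\mathcal G_{K^+}(X)$ generated by the seminorms $$p_{x^*}(\langle\tilde A,\tilde B\rangle)=|\inf x^*(\tilde A)-\inf x^*(\tilde B)|,\qquad x^*\in K^+.$$ (i) The cone $\mathcal K_{K^+}(X)$ is closed in $\tau_{\mathcal P}$. (ii) If $K$ is pointed (that is, $K\cap(-K)=\{0\}$) and there is a nonempty dually $K$-bounded subset of $X$ that is not $K$-bounded, then the interior of $\mathcal K_{K^+}(X)$ in $\tau_{\mathcal P}$ is empty. -/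

import Mathlib

open scoped Pointwise

namespace Radstrom

variable {X : Type*} [NormedAddCommGroup X] [NormedSpace ℝ X]

/-- The positive polar `K⁺` of `K` in the topological dual of `X`. -/
def polar (K : ProperCone ℝ X) : Set (StrongDual ℝ X) :=
  {f | ∀ x ∈ K, 0 ≤ f x}

/-- `A` is `K`-bounded: `A ⊆ ℓ D_X + K` for some `ℓ ≥ 0`, with `D_X` the closed unit ball. -/
def IsConeBounded (K : ProperCone ℝ X) (A : Set X) : Prop :=
  ∃ l : ℝ, 0 ≤ l ∧ A ⊆ l • Metric.closedBall (0 : X) 1 + (K : Set X)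

/-- `A` is dually `K`-bounded: `f(A)` is bounded from below for every `f ∈ K⁺`. -/
def IsDuallyBounded (K : ProperCone ℝ X) (A : Set X) : Prop :=
  ∀ f ∈ polar K, BddBelow (f '' A)

/-- `Ã = cl conv (A + K)`. -/
def hull (K : ProperCone ℝ X) (A : Set X) : Set X :=
  closure (convexHull ℝ (A + (K : Set X)))

/-- The nonempty `K`-bounded sets. -/
def coneBoundedSets (K : ProperCone ℝ X) : Set (Set X) :=
  {A | A.Nonempty ∧ IsConeBounded K A}

/-- The nonempty dually `K`-bounded sets. -/
def duallyBoundedSets (K : ProperCone ℝ X) : Set (Set X) :=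
  {A | A.Nonempty ∧ IsDuallyBounded K A}

/-- `C_G(X)`: the sets `Ã`, where `A` is nonempty and dually `K`-bounded but not `K`-bounded. -/
def goossensHulls (K : ProperCone ℝ X) : Set (Set X) :=
  hull K '' (duallyBoundedSets K \ coneBoundedSets K)

/-- `C_{K⁺}(X)`: the sets `Ã`, where `A` is nonempty and dually `K`-bounded. -/
def duallyBoundedHulls (K : ProperCone ℝ X) : Set (Set X) :=
  hull K '' duallyBoundedSets K

/-- `m_A(f) = inf f(A)`, to be used for `f ∈ K⁺` and nonempty dually `K`-bounded `A`, where
the infimum is finite. -/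
noncomputable def infOn (f : StrongDual ℝ X) (A : Set X) : ℝ := sInf (f '' A)

section lemmas

variable {K : ProperCone ℝ X} {A B S T : Set X}

theorem zero_mem_polar (K : ProperCone ℝ X) : (0 : StrongDual ℝ X) ∈ polar K :=
  fun _ _ => le_rfl

theorem subset_hull (K : ProperCone ℝ X) (A : Set X) : A ⊆ hull K A := fun a ha =>
  subset_closure (subset_convexHull ℝ _ ⟨a, ha, 0, K.zero_mem, add_zero a⟩)

theorem le_on_hull {f : StrongDual ℝ X} (hf : f ∈ polar K) {c : ℝ} (h : ∀ a ∈ A, c ≤ f a) :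
    ∀ x ∈ hull K A, c ≤ f x := by
  have hsub : hull K A ⊆ f ⁻¹' Set.Ici c := by
    refine closure_minimal (convexHull_min ?_ ?_) (isClosed_Ici.preimage f.continuous)
    · rintro _ ⟨a, ha, k, hk, rfl⟩
      have h1 := h a ha
      have h2 := hf k hk
      simp only [Set.mem_preimage, Set.mem_Ici, map_add]
      linarith
    · exact (convex_Ici c).linear_preimage f.toLinearMap
  exact fun x hx => hsub hx

theorem lowerBounds_hull {f : StrongDual ℝ X} (hf : f ∈ polar K) (A : Set X) :
    lowerBounds (f '' hull K A) = lowerBounds (f '' A) := by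
  apply Set.Subset.antisymm
  · exact lowerBounds_mono_set (Set.image_mono (subset_hull K A))
  · rintro c hc _ ⟨x, hx, rfl⟩
    exact le_on_hull hf (fun a ha => hc ⟨a, ha, rfl⟩) x hx

theorem hull_mem (h : A ∈ duallyBoundedSets K) : hull K A ∈ duallyBoundedSets K := by
  refine ⟨h.1.mono (subset_hull K A), fun f hf => ?_⟩
  unfold BddBelow
  rw [lowerBounds_hull hf]
  exact h.2 f hf

theorem mem_of_mem_hulls (h : S ∈ duallyBoundedHulls K) : S ∈ duallyBoundedSets K := by
  obtain ⟨A, hA, rfl⟩ := h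
  exact hull_mem hA

/-- `inf f(Ã) = inf f(A)` for `f ∈ K⁺`. -/
theorem infOn_hull {f : StrongDual ℝ X} (hf : f ∈ polar K) (hA : A ∈ duallyBoundedSets K) :
    infOn f (hull K A) = infOn f A := by
  have h := isGLB_csInf (hA.1.image f) (hA.2 f hf)
  rw [IsGLB, ← lowerBounds_hull hf] at h
  exact IsGLB.csInf_eq h ((hull_mem hA).1.image f)

theorem infOn_add {f : StrongDual ℝ X} (hf : f ∈ polar K) (hA : A ∈ duallyBoundedSets K)
    (hB : B ∈ duallyBoundedSets K) : infOn f (A + B) = infOn f A + infOn f B := by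
  unfold infOn
  rw [Set.image_add, csInf_add (hA.1.image f) (hA.2 f hf) (hB.1.image f) (hB.2 f hf)]

theorem infOn_smul (f : StrongDual ℝ X) {c : ℝ} (hc : 0 ≤ c) (A : Set X) :
    infOn f (c • A) = c * infOn f A := by
  unfold infOn
  rw [Set.image_smul_comm (f : X → ℝ) c A (fun x => map_smul f c x),
    Real.sInf_smul_of_nonneg hc, smul_eq_mul]

theorem add_mem (hA : A ∈ duallyBoundedSets K) (hB : B ∈ duallyBoundedSets K) :
    A + B ∈ duallyBoundedSets K := by
  refine ⟨hA.1.add hB.1, fun f hf => ?_⟩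
  rw [Set.image_add]
  exact (hA.2 f hf).add (hB.2 f hf)

theorem smul_mem {c : ℝ} (hc : 0 ≤ c) (hA : A ∈ duallyBoundedSets K) :
    c • A ∈ duallyBoundedSets K := by
  refine ⟨hA.1.smul_set, fun f hf => ?_⟩
  rw [Set.image_smul_comm (f : X → ℝ) c A (fun x => map_smul f c x)]
  exact (hA.2 f hf).smul_of_nonneg hc

theorem singleton_zero_mem (K : ProperCone ℝ X) : ({0} : Set X) ∈ duallyBoundedSets K :=
  ⟨Set.singleton_nonempty 0, fun f _ => by simp⟩

theorem exists_polar_lt (hB : B.Nonempty) {x : X} (hx : x ∉ hull K B) :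
    ∃ f ∈ polar K, ∃ u : ℝ, f x < u ∧ ∀ b ∈ B, u ≤ f b := by
  obtain ⟨f, u, hxu, hu⟩ := geometric_hahn_banach_point_closed
    (convex_convexHull ℝ (B + (K : Set X))).closure isClosed_closure hx
  refine ⟨f, fun k hk => ?_, u, hxu, fun b hb => (hu b (subset_hull K B hb)).le⟩
  by_contra! hneg
  obtain ⟨b, hb⟩ := hB
  obtain ⟨n, hn⟩ := exists_nat_gt ((f b - u) / (-f k))
  have hmem : b + (n : ℝ) • k ∈ hull K B :=
    subset_closure (subset_convexHull ℝ _ ⟨b, hb, _, K.smul_mem hk n.cast_nonneg, rfl⟩)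
  have h1 := hu _ hmem
  rw [div_lt_iff₀ (by linarith)] at hn
  simp only [map_add, map_smul, smul_eq_mul] at h1
  linarith

theorem hulls_subset (hS : S ∈ duallyBoundedHulls K) (hT : T ∈ duallyBoundedHulls K)
    (h : ∀ f ∈ polar K, infOn f T ≤ infOn f S) : S ⊆ T := by
  have hS' := mem_of_mem_hulls hS
  obtain ⟨B, hB, rfl⟩ := hT
  intro x hxS
  by_contra hx
  obtain ⟨f, hf, u, hxu, hu⟩ := exists_polar_lt hB.1 hx
  have h1 : u ≤ infOn f B := le_csInf (hB.1.image f) (by rintro _ ⟨b, hb, rfl⟩; exact hu b hb)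
  have h2 : infOn f S ≤ f x := csInf_le (hS'.2 f hf) ⟨x, hxS, rfl⟩
  have h3 := h f hf
  rw [infOn_hull hf hB] at h3
  linarith

theorem hulls_ext (hS : S ∈ duallyBoundedHulls K) (hT : T ∈ duallyBoundedHulls K)
    (h : ∀ f ∈ polar K, infOn f S = infOn f T) : S = T :=
  (hulls_subset hS hT fun f hf => (h f hf).ge).antisymm
    (hulls_subset hT hS fun f hf => (h f hf).le)

/-- The neutral element is `K` itself. -/
theorem hull_singleton_zero (K : ProperCone ℝ X) : hull K {0} = (K : Set X) := by
  rw [hull, Set.singleton_add]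
  simp only [zero_add, Set.image_id']
  rw [K.convex.convexHull_eq, K.isClosed.closure_eq]

end lemmas

/-- The type of the elements `Ã` of `C_{K⁺}(X)`. -/
def HullSet (K : ProperCone ℝ X) : Type _ := {S : Set X // S ∈ duallyBoundedHulls K}

namespace HullSet

variable {K : ProperCone ℝ X}

/-- The element `Ã` for a nonempty dually `K`-bounded set `A`. -/
def mk (A : Set X) (hA : A ∈ duallyBoundedSets K) : HullSet K := ⟨hull K A, A, hA, rfl⟩

theorem mem (S : HullSet K) : S.1 ∈ duallyBoundedSets K := mem_of_mem_hulls S.2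

/-- `S ⊕ T` is the hull of `S + T`. -/
def add (S T : HullSet K) : HullSet K := mk (S.1 + T.1) (add_mem S.mem T.mem)

/-- `c ⊙ S` is the hull of `c S`, for `c ≥ 0`. -/
def smul (c : NNReal) (S : HullSet K) : HullSet K :=
  mk ((c : ℝ) • S.1) (smul_mem c.2 S.mem)

/-- The neutral element `K`, the hull of `{0}`. -/
def zero (K : ProperCone ℝ X) : HullSet K := mk {0} (singleton_zero_mem K)

theorem infOn_add {f : StrongDual ℝ X} (hf : f ∈ polar K) (S T : HullSet K) :
    infOn f (S.add T).1 = infOn f S.1 + infOn f T.1 :=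
  (infOn_hull hf (add_mem S.mem T.mem)).trans (Radstrom.infOn_add hf S.mem T.mem)

theorem infOn_smul {f : StrongDual ℝ X} (hf : f ∈ polar K) (c : NNReal) (S : HullSet K) :
    infOn f (S.smul c).1 = c * infOn f S.1 :=
  (infOn_hull hf (smul_mem c.2 S.mem)).trans (Radstrom.infOn_smul f c.2 S.1)

theorem ext_infOn {S T : HullSet K} (h : ∀ f ∈ polar K, infOn f S.1 = infOn f T.1) : S = T :=
  Subtype.ext (hulls_ext S.2 T.2 h)

/-- `Ã ⊕ B̃` is the hull of `A + B`. -/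
theorem mk_add_mk {A B : Set X} (hA : A ∈ duallyBoundedSets K) (hB : B ∈ duallyBoundedSets K) :
    (mk A hA).add (mk B hB) = mk (A + B) (add_mem hA hB) :=
  ext_infOn fun f hf => by
    rw [infOn_add hf]
    simp only [mk]
    rw [infOn_hull hf hA, infOn_hull hf hB, infOn_hull hf (add_mem hA hB),
      Radstrom.infOn_add hf hA hB]

/-- `c ⊙ Ã` is the hull of `c A`. -/
theorem smul_mk (c : NNReal) {A : Set X} (hA : A ∈ duallyBoundedSets K) :
    (mk A hA).smul c = mk ((c : ℝ) • A) (smul_mem c.2 hA) :=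
  ext_infOn fun f hf => by
    rw [infOn_smul hf]
    simp only [mk]
    rw [infOn_hull hf hA]
    exact ((infOn_hull hf (smul_mem c.2 hA)).trans (Radstrom.infOn_smul f c.2 A)).symm

end HullSet

/-- `(S, T) ∼ (S', T')` if and only if `S ⊕ T' = T ⊕ S'`. -/
def Rel (K : ProperCone ℝ X) (p q : HullSet K × HullSet K) : Prop :=
  p.1.add q.2 = p.2.add q.1

theorem rel_iff {K : ProperCone ℝ X} {p q : HullSet K × HullSet K} :
    Rel K p q ↔ ∀ f ∈ polar K,
      infOn f p.1.1 - infOn f p.2.1 = infOn f q.1.1 - infOn f q.2.1 := by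
  constructor
  · intro h f hf
    have h1 := congrArg (fun S : HullSet K => infOn f S.1) h
    simp only [HullSet.infOn_add hf] at h1
    linarith
  · intro h
    refine HullSet.ext_infOn fun f hf => ?_
    have h1 := h f hf
    simp only [HullSet.infOn_add hf]
    linarith

def setoid (K : ProperCone ℝ X) : Setoid (HullSet K × HullSet K) where
  r := Rel K
  iseqv :=
    { refl := fun _ => rel_iff.2 fun _ _ => rfl
      symm := fun h => rel_iff.2 fun f hf => (rel_iff.1 h f hf).symm
      trans := fun h h' => rel_iff.2 fun f hf => (rel_iff.1 h f hf).trans (rel_iff.1 h' f hf) }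

/-- The Rådström space `G_{K⁺}(X)` of `C_{K⁺}(X)`. -/
def Space (K : ProperCone ℝ X) : Type _ := Quotient (setoid K)

namespace Space

variable {K : ProperCone ℝ X}

/-- The class `⟨S, T⟩`. -/
def mk (S T : HullSet K) : Space K := Quotient.mk (setoid K) (S, T)

/-- `⟨S, T⟩ ↦ inf f(S) - inf f(T)`, for `f ∈ K⁺`. -/
noncomputable def gap (f : polar K) : Space K → ℝ :=
  Quotient.lift (fun p : HullSet K × HullSet K => infOn f.1 p.1.1 - infOn f.1 p.2.1)
    fun _ _ h => rel_iff.1 h f.1 f.2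

theorem gap_mk (f : polar K) (S T : HullSet K) :
    gap f (mk S T) = infOn f.1 S.1 - infOn f.1 T.1 := rfl

theorem ext_gap {g h : Space K} (H : ∀ f : polar K, gap f g = gap f h) : g = h := by
  induction g using Quotient.inductionOn with | _ p
  induction h using Quotient.inductionOn with | _ q
  exact Quotient.sound (rel_iff.2 fun f hf => H ⟨f, hf⟩)

instance : Zero (Space K) := ⟨mk (HullSet.zero K) (HullSet.zero K)⟩

/-- `⟨S, T⟩ + ⟨S', T'⟩ = ⟨S ⊕ S', T ⊕ T'⟩`. -/
instance : Add (Space K) :=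
  ⟨Quotient.map₂ (fun p q => (p.1.add q.1, p.2.add q.2)) fun p p' hp q q' hq =>
    rel_iff.2 fun f hf => by
      have h1 := rel_iff.1 hp f hf
      have h2 := rel_iff.1 hq f hf
      simp only [HullSet.infOn_add hf]
      linarith⟩

/-- `-⟨S, T⟩ = ⟨T, S⟩`. -/
instance : Neg (Space K) :=
  ⟨Quotient.map (fun p => (p.2, p.1)) fun p p' hp =>
    rel_iff.2 fun f hf => by
      have h1 := rel_iff.1 hp f hf
      simp only
      linarith⟩

/-- `c ⟨S, T⟩` is `⟨c ⊙ S, c ⊙ T⟩` for `c ≥ 0` and `⟨(-c) ⊙ T, (-c) ⊙ S⟩` for `c < 0`. -/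
noncomputable instance : SMul ℝ (Space K) :=
  ⟨fun c => Quotient.map
    (fun p => if 0 ≤ c then (p.1.smul c.toNNReal, p.2.smul c.toNNReal)
      else (p.2.smul (-c).toNNReal, p.1.smul (-c).toNNReal)) fun p p' hp =>
    rel_iff.2 fun f hf => by
      have h1 := rel_iff.1 hp f hf
      split_ifs
      · simp only [HullSet.infOn_smul hf, ← mul_sub, h1]
      · simp only [HullSet.infOn_smul hf, ← mul_sub]
        rw [← neg_sub (infOn f p.1.1), h1, neg_sub]⟩

theorem gap_zero (f : polar K) : gap f (0 : Space K) = 0 := sub_self _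

theorem gap_add (f : polar K) (g h : Space K) : gap f (g + h) = gap f g + gap f h := by
  induction g using Quotient.inductionOn with | _ p
  induction h using Quotient.inductionOn with | _ q
  change infOn f.1 (p.1.add q.1).1 - infOn f.1 (p.2.add q.2).1
    = (infOn f.1 p.1.1 - infOn f.1 p.2.1) + (infOn f.1 q.1.1 - infOn f.1 q.2.1)
  rw [HullSet.infOn_add f.2, HullSet.infOn_add f.2]
  ring

theorem gap_neg (f : polar K) (g : Space K) : gap f (-g) = -gap f g := by
  induction g using Quotient.inductionOn with | _ p
  exact (neg_sub _ _).symm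

theorem gap_smul (f : polar K) (c : ℝ) (g : Space K) : gap f (c • g) = c * gap f g := by
  induction g using Quotient.inductionOn with | _ p
  change gap f (Quotient.mk (setoid K) (if 0 ≤ c then (p.1.smul c.toNNReal, p.2.smul c.toNNReal)
      else (p.2.smul (-c).toNNReal, p.1.smul (-c).toNNReal))) = _
  split_ifs with hc
  · change infOn f.1 _ - infOn f.1 _ = c * (infOn f.1 p.1.1 - infOn f.1 p.2.1)
    rw [HullSet.infOn_smul f.2, HullSet.infOn_smul f.2, Real.coe_toNNReal c hc]
    ring
  · change infOn f.1 _ - infOn f.1 _ = c * (infOn f.1 p.1.1 - infOn f.1 p.2.1)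
    rw [HullSet.infOn_smul f.2, HullSet.infOn_smul f.2, Real.coe_toNNReal (-c) (by linarith)]
    ring

instance : AddCommGroup (Space K) where
  add_assoc a b c := ext_gap fun f => by simp only [gap_add]; ring
  zero_add a := ext_gap fun f => by simp only [gap_add, gap_zero]; ring
  add_zero a := ext_gap fun f => by simp only [gap_add, gap_zero]; ring
  add_comm a b := ext_gap fun f => by simp only [gap_add]; ring
  neg_add_cancel a := ext_gap fun f => by simp only [gap_add, gap_neg, gap_zero]; ring
  nsmul := nsmulRec
  zsmul := zsmulRec

noncomputable instance : Module ℝ (Space K) where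
  one_smul a := ext_gap fun f => by simp only [gap_smul]; ring
  mul_smul c d a := ext_gap fun f => by simp only [gap_smul]; ring
  smul_zero c := ext_gap fun f => by simp only [gap_smul, gap_zero]; ring
  smul_add c a b := ext_gap fun f => by simp only [gap_smul, gap_add]; ring
  add_smul c d a := ext_gap fun f => by simp only [gap_smul, gap_add]; ring
  zero_smul a := ext_gap fun f => by simp only [gap_smul, gap_zero]; ring

end Space

/-- The seminorm `⟨S, T⟩ ↦ |inf f(S) - inf f(T)|` on `G_{K⁺}(X)`, for `f ∈ K⁺`. -/
noncomputable def seminorms (K : ProperCone ℝ X) : SeminormFamily ℝ (Space K) (polar K) :=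
  fun f => Seminorm.of (fun g => |Space.gap f g|)
    (fun g h => by rw [Space.gap_add]; exact abs_add_le _ _)
    (fun c g => by rw [Space.gap_smul, abs_mul, Real.norm_eq_abs])

instance (K : ProperCone ℝ X) : Nonempty (polar K) := ⟨⟨0, zero_mem_polar K⟩⟩

/-- The locally convex topology `τ_P` on `G_{K⁺}(X)` generated by the seminorms above. -/
noncomputable instance (K : ProperCone ℝ X) : TopologicalSpace (Space K) :=
  (seminorms K).moduleFilterBasis.topology

theorem withSeminorms (K : ProperCone ℝ X) : WithSeminorms (seminorms K) := ⟨rfl⟩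

/-- The ordering cone `K_{K⁺}(X)`: the classes `⟨S, T⟩` with `S ⊆ T`. -/
def orderingCone (K : ProperCone ℝ X) : Set (Space K) :=
  {g | ∃ S T : HullSet K, g = Space.mk S T ∧ S.1 ⊆ T.1}

end Radstrom

/-!
Since `S ⊆ T` if and only if `inf f(T) ≤ inf f(S)` for all `f ∈ K⁺`, the ordering cone is cut out
by the `τ_P`-continuous functionals `⟨S, T⟩ ↦ inf f(S) - inf f(T)`. Hence it is closed, and it
contains no line because these functionals separate points. A `τ_P`-neighbourhood contains a
translate of the common kernel of finitely many of them, so a line-free set with nonempty interior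
forces the Rådström space to be finite-dimensional. But once `K⁺` contains two linearly independent
functionals `f₁`, `f₂`, with dual vectors `x₁`, `x₂`, the functionals given by `f₁ + n f₂` and the
classes of the hulls of `{0, x₂ - (n + 1) x₁}` form a triangular system with nonzero diagonal, so
the space is infinite-dimensional. Finally, if `K⁺` lies in a line, then `K` is `X`, a closed
half-space or a closed hyperplane, and then every dually `K`-bounded set is `K`-bounded.
-/

open Module

namespace Radstrom

section LinearAlgebra

theorem linearIndependent_of_triangular {ι R M : Type*} [LinearOrder ι] [Ring R] [NoZeroDivisors R]
    [AddCommGroup M] [Module R M] {v : ι → M} (φ : ι → M →ₗ[R] R)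
    (hlt : ∀ i j, i < j → φ j (v i) = 0) (hdiag : ∀ i, φ i (v i) ≠ 0) :
    LinearIndependent R v := by
  refine linearIndependent_iff.2 fun l hl => ?_
  by_contra hne
  have hsupp : l.support.Nonempty := Finsupp.support_nonempty_iff.2 hne
  set j := l.support.max' hsupp
  have hj : j ∈ l.support := l.support.max'_mem hsupp
  have hsum : φ j (Finsupp.linearCombination R v l) = l j * φ j (v j) := by
    rw [Finsupp.linearCombination_apply, Finsupp.sum, map_sum, Finset.sum_eq_single_of_mem j hj,
      map_smul, smul_eq_mul]
    intro i hi hij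
    rw [map_smul, hlt i j (lt_of_le_of_ne (l.support.le_max' i hi) hij), smul_zero]
  rw [hl, map_zero] at hsum
  exact mul_ne_zero (Finsupp.mem_support_iff.1 hj) (hdiag j) hsum.symm

theorem surjective_pi_of_linearIndependent {ι F V : Type*} [Finite ι] [Field F] [AddCommGroup V]
    [Module F V] {φ : ι → Dual F V} (h : LinearIndependent F φ) :
    Function.Surjective (LinearMap.pi φ) := by
  have hfun : LinearIndependent F fun i => (φ i : V → F) :=
    h.map' (LinearMap.ltoFun F V F F) (LinearMap.ker_eq_bot.2 DFunLike.coe_injective)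
  rw [← LinearMap.range_eq_top, eq_top_iff, ← span_flip_eq_top_iff_linearIndependent.2 hfun,
    Submodule.span_le]
  rintro _ ⟨x, rfl⟩
  exact ⟨x, rfl⟩

end LinearAlgebra

section WeakTopology

variable {ι 𝕜 E : Type*} [NontriviallyNormedField 𝕜] [AddCommGroup E] [Module 𝕜 E]
  [TopologicalSpace E] {φ : ι → Dual 𝕜 E}

theorem continuous_of_withSeminorms_toSeminorm (hφ : WithSeminorms fun i => (φ i).toSeminorm)
    (i : ι) : Continuous (φ i) :=
  have := hφ.topologicalAddGroup
  WithSeminorms.continuous_of_continuous_comp (norm_withSeminorms 𝕜 𝕜) (φ i) fun _ =>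
    hφ.continuous_seminorm i

theorem finiteDimensional_of_nonempty_interior (hφ : WithSeminorms fun i => (φ i).toSeminorm)
    {C : Set E} (hC : ∀ x v, (∀ c : 𝕜, x + c • v ∈ C) → v = 0) (hC_int : (interior C).Nonempty) :
    FiniteDimensional 𝕜 E := by
  obtain ⟨x, hx⟩ := hC_int
  obtain ⟨F, r, hr, hball⟩ := (hφ.mem_nhds_iff x C).1 (mem_interior_iff_mem_nhds.1 hx)
  refine FiniteDimensional.of_injective (LinearMap.pi fun i : F => φ i)
    ((injective_iff_map_eq_zero _).2 fun v hv => hC x v fun c => hball ?_)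
  rw [Seminorm.mem_ball, add_sub_cancel_left]
  refine Seminorm.finset_sup_apply_lt hr fun i hi => ?_
  have hvi : φ i v = 0 := congrFun hv ⟨i, hi⟩
  rwa [LinearMap.toSeminorm_apply, map_smul, hvi, smul_zero, norm_zero]

end WeakTopology

variable {X : Type*} [NormedAddCommGroup X] [NormedSpace ℝ X] {K : ProperCone ℝ X}

section OrderingCone

theorem mem_orderingCone_iff {g : Space K} :
    g ∈ orderingCone K ↔ ∀ f : polar K, 0 ≤ Space.gap f g := by
  constructor
  · rintro ⟨S, T, rfl, hST⟩ f
    rw [Space.gap_mk, sub_nonneg]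
    exact csInf_le_csInf (T.mem.2 f f.2) (S.mem.1.image _) (Set.image_mono hST)
  · intro hg
    induction g using Quotient.inductionOn with | _ p
    exact ⟨p.1, p.2, rfl, hulls_subset p.1.2 p.2.2 fun f hf => sub_nonneg.1 (hg ⟨f, hf⟩)⟩

/-- The functional `⟨S, T⟩ ↦ inf f(S) - inf f(T)` of `Space.gap`, bundled as a linear map. -/
noncomputable def gapLinear (f : polar K) : Dual ℝ (Space K) where
  toFun := Space.gap f
  map_add' := Space.gap_add f
  map_smul' := Space.gap_smul f

theorem withSeminorms_gapLinear (K : ProperCone ℝ X) :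
    WithSeminorms fun f : polar K => (gapLinear f).toSeminorm :=
  withSeminorms K

theorem isClosed_orderingCone (K : ProperCone ℝ X) : IsClosed (orderingCone K) := by
  have hcone : orderingCone K = ⋂ f : polar K, {g | 0 ≤ gapLinear f g} := by
    ext g
    rw [mem_orderingCone_iff, Set.mem_iInter]
    rfl
  rw [hcone]
  exact isClosed_iInter fun f => isClosed_le continuous_const
    (continuous_of_withSeminorms_toSeminorm (withSeminorms_gapLinear K) f)

theorem eq_zero_of_line_subset_orderingCone (g v : Space K)
    (h : ∀ c : ℝ, g + c • v ∈ orderingCone K) : v = 0 := by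
  refine Space.ext_gap fun f => ?_
  rw [Space.gap_zero]
  by_contra hne
  have hnonneg := mem_orderingCone_iff.1 (h (-(Space.gap f g + 1) / Space.gap f v)) f
  rw [Space.gap_add, Space.gap_smul, div_mul_cancel₀ _ hne] at hnonneg
  linarith

theorem interior_orderingCone_eq_empty (h : ¬ FiniteDimensional ℝ (Space K)) :
    interior (orderingCone K) = ∅ :=
  Set.not_nonempty_iff_eq_empty.1 <| mt
    (finiteDimensional_of_nonempty_interior (withSeminorms_gapLinear K)
      eq_zero_of_line_subset_orderingCone) h

end OrderingCone

section InfiniteDimension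

theorem mem_duallyBoundedSets_of_finite {A : Set X} (hA : A.Finite) (hne : A.Nonempty) :
    A ∈ duallyBoundedSets K :=
  ⟨hne, fun f _ => (hA.image f).bddBelow⟩

/-- The class `⟨S, K⟩` in the Rådström space, where `S` is the hull of `{0, v}`. -/
def pairClass (K : ProperCone ℝ X) (v : X) : Space K :=
  Space.mk
    (HullSet.mk {0, v} (mem_duallyBoundedSets_of_finite (Set.toFinite _) (Set.insert_nonempty _ _)))
    (HullSet.zero K)

theorem infOn_mk {f : StrongDual ℝ X} (hf : f ∈ polar K) {A : Set X}
    (hA : A ∈ duallyBoundedSets K) : infOn f (HullSet.mk A hA).1 = infOn f A :=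
  infOn_hull hf hA

theorem gap_pairClass (f : polar K) (v : X) : Space.gap f (pairClass K v) = min 0 (f.1 v) := by
  rw [pairClass, Space.gap_mk, HullSet.zero, infOn_mk f.2, infOn_mk f.2, infOn, infOn,
    Set.image_pair, Set.image_singleton, csInf_pair, csInf_singleton, map_zero, sub_zero]

theorem not_finiteDimensional_space {f₁ f₂ : StrongDual ℝ X} (hf₁ : f₁ ∈ polar K)
    (hf₂ : f₂ ∈ polar K) (hindep : LinearIndependent ℝ ![f₁, f₂]) :
    ¬ FiniteDimensional ℝ (Space K) := by
  have hsurj := surjective_pi_of_linearIndependent <| hindep.map' (ContinuousLinearMap.coeLM ℝ)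
    (LinearMap.ker_eq_bot.2 ContinuousLinearMap.coe_injective)
  obtain ⟨x₁, hx₁⟩ := hsurj ![1, 0]
  obtain ⟨x₂, hx₂⟩ := hsurj ![0, 1]
  have h₁₁ : f₁ x₁ = 1 := congrFun hx₁ 0
  have h₂₁ : f₂ x₁ = 0 := congrFun hx₁ 1
  have h₁₂ : f₁ x₂ = 0 := congrFun hx₂ 0
  have h₂₂ : f₂ x₂ = 1 := congrFun hx₂ 1
  let f (n : ℕ) : polar K :=
    ⟨f₁ + (n : ℝ) • f₂, fun x hx => add_nonneg (hf₁ x hx) (mul_nonneg n.cast_nonneg (hf₂ x hx))⟩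
  let v (n : ℕ) : X := x₂ - (n + 1 : ℝ) • x₁
  have hfv (m n : ℕ) : (f m).1 (v n) = m - (n + 1) := by
    simp only [f, v, add_apply, smul_apply, map_sub, map_smul, smul_eq_mul, h₁₁, h₁₂, h₂₁, h₂₂]
    ring
  have hgap (m n : ℕ) : gapLinear (f m) (pairClass K (v n)) = min 0 (m - (n + 1) : ℝ) :=
    (gap_pairClass (f m) (v n)).trans (by rw [hfv])
  have hli : LinearIndependent ℝ fun n => pairClass K (v n) := by
    refine linearIndependent_of_triangular (fun m => gapLinear (f m)) (fun n m hnm => ?_)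
      fun n => ?_
    · have hle : (n + 1 : ℝ) ≤ m := by exact_mod_cast hnm
      rw [hgap, min_eq_left (sub_nonneg.2 hle)]
    · rw [hgap, min_eq_right (by linarith)]
      linarith
  intro hfin
  have := hli.finite
  exact not_finite ℕ

end InfiniteDimension

section PolarInLine

theorem mem_of_forall_polar_nonneg {x : X} (h : ∀ f ∈ polar K, 0 ≤ f x) : x ∈ K := by
  by_contra hx
  obtain ⟨f, hf, hfx⟩ := K.hyperplane_separation_point hx
  exact hfx.not_ge (h f hf)

theorem isConeBounded_of_subset_add {A B : Set X} (hB : Bornology.IsBounded B)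
    (hAB : A ⊆ B + (K : Set X)) : IsConeBounded K A := by
  obtain ⟨l, hl, hBl⟩ := hB.subset_closedBall_lt 0 0
  refine ⟨l, hl.le, hAB.trans (Set.add_subset_add_right ?_)⟩
  rwa [smul_unitClosedBall_of_nonneg hl.le]

theorem IsDuallyBounded.isConeBounded_of_polar_subset_span {A : Set X} (hA : IsDuallyBounded K A)
    {f : StrongDual ℝ X} (hf : f ∈ polar K) (hspan : polar K ⊆ Submodule.span ℝ {f}) :
    IsConeBounded K A := by
  obtain ⟨e, he⟩ : ∃ e, f e • f = f := by
    by_cases hf0 : f = 0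
    · exact ⟨0, by rw [hf0, smul_zero]⟩
    · obtain ⟨x, hx⟩ := DFunLike.ne_iff.1 hf0
      exact ⟨(f x)⁻¹ • x, by rw [map_smul, smul_eq_mul, inv_mul_cancel₀ hx, one_smul]⟩
  have hpolar : ∀ g ∈ polar K, ∀ x, g x = g e * f x := by
    intro g hg x
    obtain ⟨t, rfl⟩ := Submodule.mem_span_singleton.1 (hspan hg)
    have hx : f e * f x = f x := DFunLike.congr_fun he x
    rw [smul_apply, smul_apply, smul_eq_mul, smul_eq_mul, mul_assoc, hx]
  obtain ⟨c, hc⟩ := hA f hf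
  have hcA : ∀ a ∈ A, c ≤ f a := fun a ha => hc ⟨a, ha, rfl⟩
  -- Every `a ∈ A` lies in `t • e + K` for some `t` in a compact interval: `t = c` works if `e ∈ K`,
  -- and otherwise `f` is bounded above on `A`, so that `t = f a` works.
  obtain ⟨d, hd⟩ : ∃ d, ∀ a ∈ A, ∃ t ∈ Set.Icc c d, ∀ g ∈ polar K, g e * t ≤ g e * f a := by
    by_cases hpos : ∀ g ∈ polar K, 0 ≤ g e
    · exact ⟨c, fun a ha => ⟨c, Set.left_mem_Icc.2 le_rfl, fun g hg =>
        mul_le_mul_of_nonneg_left (hcA a ha) (hpos g hg)⟩⟩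
    · push Not at hpos
      obtain ⟨g, hg, hge⟩ := hpos
      obtain ⟨b, hb⟩ := hA g hg
      refine ⟨b / g e, fun a ha => ⟨f a, ⟨hcA a ha, ?_⟩, fun _ _ => le_rfl⟩⟩
      rw [le_div_iff_of_neg hge, mul_comm, ← hpolar g hg]
      exact hb ⟨a, ha, rfl⟩
  have hseg : Bornology.IsBounded ((fun t : ℝ => t • e) '' Set.Icc c d) :=
    (isCompact_Icc.image (by fun_prop)).isBounded
  refine isConeBounded_of_subset_add hseg fun a ha => ?_
  obtain ⟨t, ht, hta⟩ := hd a ha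
  refine ⟨t • e, ⟨t, ht, rfl⟩, a - t • e, mem_of_forall_polar_nonneg fun g hg => ?_,
    add_sub_cancel _ _⟩
  rw [map_sub, map_smul, smul_eq_mul, sub_nonneg, hpolar g hg a, mul_comm t]
  exact hta g hg

theorem exists_polar_linearIndependent {A : Set X} (hA : IsDuallyBounded K A)
    (hA' : ¬ IsConeBounded K A) :
    ∃ f₁ ∈ polar K, ∃ f₂ ∈ polar K, LinearIndependent ℝ ![f₁, f₂] := by
  have hspan : ∀ f ∈ polar K, ∃ g ∈ polar K, g ∉ Submodule.span ℝ {f} := fun f hf =>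
    Set.not_subset.1 (mt (hA.isConeBounded_of_polar_subset_span hf) hA')
  obtain ⟨f₁, hf₁, hf₁0⟩ := hspan 0 (zero_mem_polar K)
  obtain ⟨f₂, hf₂, hf₂f₁⟩ := hspan f₁ hf₁
  have hne : f₁ ≠ 0 := (ne_of_mem_of_not_mem (Submodule.zero_mem _) hf₁0).symm
  exact ⟨f₁, hf₁, f₂, hf₂, (LinearIndependent.pair_iff' hne).2 fun c hc =>
    hf₂f₁ (Submodule.mem_span_singleton.2 ⟨c, hc⟩)⟩

end PolarInLine

end Radstrom

theorem proposition4p5_general {X : Type*} [NormedAddCommGroup X] [NormedSpace ℝ X]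
    (K : ProperCone ℝ X) :
    IsClosed (Radstrom.orderingCone K) ∧
    ((Radstrom.goossensHulls K).Nonempty → interior (Radstrom.orderingCone K) = ∅) := by
  refine ⟨Radstrom.isClosed_orderingCone K, ?_⟩
  rintro ⟨_, A, ⟨⟨hne, hA⟩, hA'⟩, rfl⟩
  obtain ⟨f₁, hf₁, f₂, hf₂, hindep⟩ :=
    Radstrom.exists_polar_linearIndependent hA fun hbdd => hA' ⟨hne, hbdd⟩
  exact Radstrom.interior_orderingCone_eq_empty
    (Radstrom.not_finiteDimensional_space hf₁ hf₂ hindep)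

theorem proposition4p5 {X : Type*} [NormedAddCommGroup X] [NormedSpace ℝ X]
    (K : ProperCone ℝ X) :
    IsClosed (Radstrom.orderingCone K) ∧
    ((K : Set X) ∩ -(K : Set X) = {0} → (Radstrom.goossensHulls K).Nonempty →
      interior (Radstrom.orderingCone K) = ∅) :=
  (proposition4p5_general K).imp_right fun hempty _ => hempty
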